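/- **Games.** For a family $\mathcal A$ of sets and a family $\mathcal B$ of sets (or of sequences), $G_1(\mathcal A,\mathcal B)$ is the game in which, in round $n\in\omega$, One plays $A_n\in\mathcal A$ and then Two plays $B_n\in A_n$. Two wins if $\{B_n:n\in\omega\}\in\mathcal B$ (if $(B_n)_{n\in\omega}\in\mathcal B$, when $\mathcal B$ is a family of sequences); otherwise One wins. A player who has no legal move loses. $\neg\mathcal B$ denotes the complement of $\mathcal B$. We write $\mathrm I\uparrow G$ (resp. $\mathrm{II}\uparrow G$) if One (resp. Two) has a winning strategy depending on the full history of the play. **Families.** Let $C_k(X)$ be the set of continuous functions $X\to\mathbb R$ with the compact-open topology, and $\mathbf 0\in C_k(X)$ the zero function. Let $K(X)$ be the set of nonempty compact subsets of $X$. Fix one of two conventions, to be used throughout: either only open sets $U\neq X$ are *admissible* (covers are non-trivial), or all open sets of $X$ are admissible. Then $\mathcal K_X$ is the set of all $k$-covers of $X$, that is, of all covers $\mathscr U$ of $X$ by admissible open sets such that each compact $K\subseteq X$ lies in some $U\in\mathscr U$; and $\mathscr N[K(X)]=\{\mathscr N(K):K\in K(X)\}$, where $\mathscr N(K)$ is the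 set of all admissible open $U\supseteq K$. For a space $Y$ and $y\in Y$: $\mathscr N_y$ is the set of open neighbourhoods of $y$; $\Gamma_{Y,y}$ is the set of sequences in $Y$ that converge to $y$; $\Omega_{Y,y}=\{A\subseteq Y: y\in\overline A\}$; $\mathscr T_Y$ is the set of nonempty open subsets of $Y$; $CD_Y$ is the set of closed and discrete subsets of $Y$; $\mathcal D_Y$ is the set of dense subsets of $Y$. **Theorem.** Let $X$ be a nonempty Tychonoff space. Under either convention, the following are equivalent. (a) $\mathrm I\uparrow G_1(\mathscr N[K(X)],\neg\mathcal K_X)$ (a variant of the compact-open game); (b) $\mathrm I\uparrow G_1(\mathscr N_{\mathbf 0},\neg\Gamma_{C_k(X),\mathbf 0})$ (Gruenhage's $W$-game); (c) $\mathrm I\uparrow G_1(\mathscr N_{\mathbf 0},\neg\Omega_{C_k(X),\mathbf 0})$ (the closure game); (d) $\mathrm I\uparrow G_1(\mathscr T_{C_k(X)},CD_{C_k(X)})$ (the closed discrete selection game); (e) $\mathrm{II}\uparrow G_1(\mathcal K_X,\mathcal K_X)$ (a variant of the Rothberger game); (f) $\mathrm{II}\uparrow G_1(\Omega_{C_k(X),\mathbf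 0},\Omega_{C_k(X),\mathbf 0})$ (the countable fan tightness game); (g) $\mathrm{II}\uparrow G_1(\mathcal D_{C_k(X)},\Omega_{C_k(X),\mathbf 0})$ (the countable dense fan tightness game). -/

import Mathlib

open Set Filter Topology

namespace SelectionGames

/-! ### Single selection games

In the game `G₁(𝒜, ℬ)`, in round `n` One plays a set `a n ∈ 𝒜` and then Two plays a point
`b n ∈ a n`. Two wins if the sequence of answers belongs to `ℬ`, otherwise One wins. A player who
is the first to make an illegal move, or who has no legal move, loses. -/

section Games

variable {E : Type*}

/-- The moves of both players in the rounds `0, …, n - 1`. -/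
def history (a : ℕ → Set E) (b : ℕ → E) (n : ℕ) : List (Set E × E) :=
  (List.range n).map fun i => (a i, b i)

/-- One has a winning strategy (of perfect information) in `G₁(𝒜, ℬ)`: when One follows `σ`, then
One moves legally as long as Two has done so, and if Two always moves legally, then
Two's sequence of answers is not in `ℬ`. -/
def OneWins (𝒜 : Set (Set E)) (ℬ : Set (ℕ → E)) : Prop :=
  ∃ σ : List (Set E × E) → Set E, ∀ (a : ℕ → Set E) (b : ℕ → E),
    (∀ n, a n = σ (history a b n)) →
      (∀ n, (∀ m < n, b m ∈ a m) → a n ∈ 𝒜) ∧ ((∀ n, b n ∈ a n) → b ∉ ℬ)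

/-- Two has a winning strategy (of perfect information) in `G₁(𝒜, ℬ)`: when Two follows `τ`, then
Two moves legally as long as One has done so, and if One always moves legally, then
Two's sequence of answers is in `ℬ`. -/
def TwoWins (𝒜 : Set (Set E)) (ℬ : Set (ℕ → E)) : Prop :=
  ∃ τ : List (Set E × E) → Set E → E, ∀ (a : ℕ → Set E) (b : ℕ → E),
    (∀ n, b n = τ (history a b n) (a n)) →
      (∀ n, (∀ m ≤ n, a m ∈ 𝒜) → b n ∈ a n) ∧ ((∀ n, a n ∈ 𝒜) → b ∈ ℬ)

/-- The sequences `b` with `{b n : n ∈ ω} ∈ ℬ`, for a collection `ℬ` of sets. -/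
def rangeIn (ℬ : Set (Set E)) : Set (ℕ → E) := {b | range b ∈ ℬ}

end Games

/-! ### Covers of a space `X`

The parameter `nontrivial` fixes the convention about covers. If it holds, then the whole space is
admitted neither as a member of a cover nor as a neighbourhood of a compact set; if it fails, then
all open sets are admitted. -/

section Covers

variable (X : Type*) [TopologicalSpace X]

/-- The open sets admitted as members of covers. -/
def admissibleOpens (nontrivial : Prop) : Set (Set X) :=
  {U | IsOpen U ∧ (nontrivial → U ≠ univ)}

/-- `K(X)`, the nonempty compact subsets of `X`. -/
def compacts : Set (Set X) := {K | K.Nonempty ∧ IsCompact K}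

/-- `𝒩[K(X)] = {𝒩(K) : K ∈ K(X)}`, where `𝒩(K)` consists of the admissible open `U ⊇ K`. -/
def compactNhds (nontrivial : Prop) : Set (Set (Set X)) :=
  (fun K => {U | U ∈ admissibleOpens X nontrivial ∧ K ⊆ U}) '' compacts X

/-- `𝒦_X`, the `k`-covers of `X`. -/
def kCovers (nontrivial : Prop) : Set (Set (Set X)) :=
  {𝒰 | 𝒰 ⊆ admissibleOpens X nontrivial ∧ ⋃₀ 𝒰 = univ ∧
    ∀ K : Set X, IsCompact K → ∃ U ∈ 𝒰, K ⊆ U}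

end Covers

/-! ### Families at a point of a space `Y` -/

section Spaces

variable {Y : Type*} [TopologicalSpace Y]

/-- `𝒩_y`, the open neighbourhoods of `y`. -/
def openNhds (y : Y) : Set (Set Y) := {U | IsOpen U ∧ y ∈ U}

/-- `Γ_{Y,y}`, the sequences converging to `y`. -/
def convergent (y : Y) : Set (ℕ → Y) := {s | Tendsto s atTop (𝓝 y)}

/-- `Ω_{Y,y}`, the blades of `y`: the sets with `y` in their closure. -/
def blades (y : Y) : Set (Set Y) := {A | y ∈ closure A}

variable (Y)

/-- `𝒯_Y`, the nonempty open subsets of `Y`. -/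
def nonemptyOpens : Set (Set Y) := {W | IsOpen W ∧ W.Nonempty}

/-- `CD_Y`, the subsets of `Y` that are closed and discrete. -/
def closedDiscrete : Set (Set Y) := {S | IsClosed S ∧ DiscreteTopology S}

/-- `𝒟_Y`, the dense subsets of `Y`. -/
def denseSets : Set (Set Y) := {D | Dense D}

end Spaces

end SelectionGames

/-!
The seven games are linked by three ideas.

*Strengthening One's strategy.* A winning strategy for One in the compact-open game amounts to a
map `κ` from finite sequences of open sets to compact sets such that every sequence `U` of
admissible open sets with `κ (U 0, …, U (n - 1)) ⊆ U n` for all `n` has the property that each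
compact set lies in some `U n` (`oneWins_compactNhds_iff`). If One instead plays the union of the
sets `κ l` over all subsequences `l` of the past moves, then every subsequence of a play is again a
play against `κ`, and so each compact set lies in all but finitely many `U n`, even
if inadmissible answers are allowed (`exists_forall_eventually_subset`). In `C(X, ℝ)`, playing the
functions that are smaller than `1 / (n + 1)` on these compact sets then forces convergence to `0`
(`oneWins_convergent`).

*Duality.* If the moves of One in a game meet all moves of One in a second game, then One's
strategy in the first tells Two what to select in the second (`OneWins.twoWins`). Conversely, if
every selection from the family `𝒜` yields a member of `𝒜'`, then Two's
winning strategy in the game on `𝒜'` gives One a winning strategy in the game on `𝒜`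
(`TwoWins.oneWins`): after any history, there is `A ∈ 𝒜` each of whose points is the answer of
Two's strategy to some legal move, as otherwise the points that are no such answer,
one in each `A`, would form a legal move without an answer.

*Test functions.* A basic open set of `C(X, ℝ)` restricts functions on a compact set `K` only. When
One plays nonempty open sets of `C(X, ℝ)`, each of them yields such a `K`, and if
`K ⊆ U` with `U` open, then complete regularity gives a function in the open set which is the
constant `n + 1` off `U`. If some compact set `L` is contained in none of the `U n`, then the
functions so obtained take the value `n + 1` on `L`. Such functions form a closed discrete
set, and `0` is not in its closure, so One's strategies in the closed discrete selection game
and in the game dual to the dense fan tightness game both yield one in the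
compact-open game (`oneWins_compactNhds_of_oneWins_nonemptyOpens`).
-/

namespace SelectionGames

/-! ### Strategies that read only the opponent's moves -/

section Games

/-- The list of the first `n` terms of a sequence. -/
def initialSegment {α : Type*} (b : ℕ → α) (n : ℕ) : List α := (List.range n).map b

/-- Turn a list of moves into a list of responses, where `p` computes a response from
the previous responses and the current move. -/
def replay {α β : Type*} (p : List β → α → β) (l : List α) : List β :=
  l.foldl (fun h x => h ++ [p h x]) []

lemma initialSegment_succ {α : Type*} (b : ℕ → α) (n : ℕ) :
    initialSegment b (n + 1) = initialSegment b n ++ [b n] := by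
  simp [initialSegment, List.range_succ]

lemma replay_initialSegment {α β : Type*} (p : List β → α → β) (b : ℕ → α) (n : ℕ) :
    replay p (initialSegment b n) =
      initialSegment (fun i => p (replay p (initialSegment b i)) (b i)) n := by
  induction n with
  | zero => rfl
  | succ n ih =>
    rw [initialSegment_succ, initialSegment_succ, ← ih]
    simp [replay]

lemma initialSegment_getD {α : Type*} (l : List α) (x : α) :
    initialSegment (fun n => l.getD n x) l.length = l :=
  List.ext_getElem (by simp [initialSegment]) fun i h₁ h₂ => by simp [initialSegment, h₂]

variable {E : Type*} {𝒜 𝒜' : Set (Set E)} {ℬ ℬ' : Set (ℕ → E)}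

/-- A winning strategy for One may be taken to depend on Two's moves only and to be legal
everywhere. -/
lemma oneWins_iff (h𝒜 : 𝒜.Nonempty) :
    OneWins 𝒜 ℬ ↔ ∃ s : List E → Set E, (∀ l, s l ∈ 𝒜) ∧
      ∀ b : ℕ → E, (∀ n, b n ∈ s (initialSegment b n)) → b ∉ ℬ := by
  constructor
  · rintro ⟨σ, hσ⟩
    obtain ⟨A₀, hA₀⟩ := h𝒜
    let H : List E → List (Set E × E) := replay fun h x => (σ h, x)
    classical
    refine ⟨fun l => if σ (H l) ∈ 𝒜 then σ (H l) else A₀, fun l => ?_, fun b hb => ?_⟩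
    · dsimp only
      split_ifs with h
      exacts [h, hA₀]
    · have key := hσ (fun n => σ (H (initialSegment b n))) b fun n =>
        congrArg σ (replay_initialSegment _ b n)
      have legal : ∀ n, b n ∈ σ (H (initialSegment b n)) := by
        intro n
        induction n using Nat.strong_induction_on with
        | _ n ih =>
          simpa only [if_pos (key.1 n ih)] using hb n
      exact key.2 legal
  · rintro ⟨s, hs, hwin⟩
    refine ⟨fun h => s (h.map Prod.snd), fun a b hab => ?_⟩
    have ha : ∀ n, a n = s (initialSegment b n) := fun n => by
      rw [hab n]
      simp [history, initialSegment, Function.comp_def]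
    exact ⟨fun n _ => ha n ▸ hs _, fun hb => hwin b fun n => ha n ▸ hb n⟩

/-- A winning strategy for Two may be taken to depend on One's moves only and to answer legal moves
legally even after an illegal history. -/
lemma twoWins_iff :
    TwoWins 𝒜 ℬ ↔ ∃ t : List (Set E) → Set E → E, (∀ l, ∀ A ∈ 𝒜, t l A ∈ A) ∧
      ∀ a : ℕ → Set E, (∀ n, a n ∈ 𝒜) → (fun n => t (initialSegment a n) (a n)) ∈ ℬ := by
  constructor
  · rintro ⟨τ, hτ⟩
    let H : List (Set E) → List (Set E × E) := replay fun h A => (A, τ h A)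
    have key : ∀ a : ℕ → Set E, _ := fun a =>
      hτ a (fun n => τ (H (initialSegment a n)) (a n)) fun n =>
        congrArg (τ · (a n)) (replay_initialSegment _ a n)
    have legal : ∀ l : List (Set E), (∀ B ∈ l, B ∈ 𝒜) → ∀ A ∈ 𝒜, τ (H l) A ∈ A := by
      intro l hl A hA
      have h := (key fun n => l.getD n A).1 l.length fun m _ => by
        rcases lt_or_ge m l.length with hm | hm
        · simpa [hm] using hl _ (List.getElem_mem hm)
        · simpa [hm] using hA
      simpa only [initialSegment_getD, List.getD_eq_default l A le_rfl] using h
    classical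
    refine ⟨fun l A => if ∀ B ∈ l, B ∈ 𝒜 then τ (H l) A else τ (H []) A, fun l A hA => ?_,
      fun a ha => ?_⟩
    · dsimp only
      split_ifs with h
      exacts [legal l h A hA, legal [] (by simp) A hA]
    · have h : ∀ n, ∀ B ∈ initialSegment a n, B ∈ 𝒜 := fun n B hB => by
        obtain ⟨i, -, rfl⟩ := List.mem_map.1 hB
        exact ha i
      simpa only [if_pos (h _)] using (key a).2 ha
  · rintro ⟨t, ht, hwin⟩
    refine ⟨fun h A => t (h.map Prod.fst) A, fun a b hab => ?_⟩
    have hb : b = fun n => t (initialSegment a n) (a n) := funext fun n => by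
      rw [hab n]
      simp [history, initialSegment, Function.comp_def]
    subst hb
    exact ⟨fun n h => ht _ _ (h n le_rfl), hwin a⟩

lemma OneWins.mono (h : OneWins 𝒜 ℬ) (hℬ : ℬ' ⊆ ℬ) : OneWins 𝒜 ℬ' := by
  obtain ⟨σ, hσ⟩ := h
  exact ⟨σ, fun a b hab => ⟨(hσ a b hab).1, fun hb hb' => (hσ a b hab).2 hb (hℬ hb')⟩⟩

lemma TwoWins.anti (h : TwoWins 𝒜 ℬ) (h𝒜 : 𝒜' ⊆ 𝒜) : TwoWins 𝒜' ℬ := by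
  obtain ⟨τ, hτ⟩ := h
  exact ⟨τ, fun a b hab => ⟨fun n ha => (hτ a b hab).1 n fun m hm => h𝒜 (ha m hm),
    fun ha => (hτ a b hab).2 fun n => h𝒜 (ha n)⟩⟩

/-! ### Duality of games -/

/-- If each `A ∈ 𝒜` meets each `A' ∈ 𝒜'`, then Two can answer moves from `𝒜'` by points of the sets
that One would play from `𝒜`. -/
lemma OneWins.twoWins [Nonempty E] (h𝒜 : 𝒜.Nonempty)
    (hmeet : ∀ A ∈ 𝒜, ∀ A' ∈ 𝒜', (A ∩ A').Nonempty)
    (h : OneWins 𝒜 ℬᶜ) : TwoWins 𝒜' ℬ := by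
  obtain ⟨s, hs, hwin⟩ := (oneWins_iff h𝒜).1 h
  have hp : ∀ (h : List E) (A' : Set E), ∃ x, A' ∈ 𝒜' → x ∈ s h ∩ A' := fun h A' => by
    by_cases hA' : A' ∈ 𝒜'
    · exact (hmeet _ (hs h) _ hA').imp fun x hx _ => hx
    · exact ⟨Classical.arbitrary E, fun h => (hA' h).elim⟩
  choose p hp using hp
  refine twoWins_iff.2 ⟨fun l A' => p (replay p l) A', fun l A' hA' => (hp _ _ hA').2,
    fun a ha => ?_⟩
  refine not_not.1 (hwin _ fun n => ?_)
  rw [← replay_initialSegment]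
  exact (hp _ _ (ha n)).1

/-- If the image of each choice function on `𝒜` belongs to `𝒜'`, then a winning strategy for Two
in the game on `𝒜'` gives One a winning strategy in the game on `𝒜`. -/
lemma TwoWins.oneWins (h𝒜 : 𝒜.Nonempty)
    (hsel : ∀ f : Set E → E, (∀ A ∈ 𝒜, f A ∈ A) → f '' 𝒜 ∈ 𝒜') (h : TwoWins 𝒜' ℬ) :
    OneWins 𝒜 ℬᶜ := by
  obtain ⟨t, ht, hwin⟩ := twoWins_iff.1 h
  have hC : ∀ l : List (Set E), ∃ A ∈ 𝒜, ∀ x ∈ A, ∃ A' ∈ 𝒜', t l A' = x := by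
    intro l
    by_contra! hcon
    -- Choose a point of each `A ∈ 𝒜` that Two's strategy does not select after `l`.
    have hf : ∀ A, ∃ x, A ∈ 𝒜 → x ∈ A ∧ ∀ A' ∈ 𝒜', t l A' ≠ x := fun A => by
      by_cases hA : A ∈ 𝒜
      · exact (hcon A hA).imp fun x hx _ => hx
      · exact ⟨t l A, fun h => (hA h).elim⟩
    choose f hf using hf
    have himg := hsel f fun A hA => (hf A hA).1
    obtain ⟨A, hA, hfA⟩ := ht l _ himg
    exact (hf A hA).2 _ himg hfA.symm
  choose C hC𝒜 hC using hC
  have hp : ∀ (l : List (Set E)) (x : E), ∃ A', x ∈ C l → A' ∈ 𝒜' ∧ t l A' = x := fun l x => by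
    by_cases hx : x ∈ C l
    · obtain ⟨A', h⟩ := hC l x hx
      exact ⟨A', fun _ => h⟩
    · exact ⟨∅, fun h => (hx h).elim⟩
  choose p hp using hp
  refine (oneWins_iff h𝒜).2 ⟨fun l => C (replay p l), fun l => hC𝒜 _, fun b hb => ?_⟩
  have hb' := hwin (fun n => p (replay p (initialSegment b n)) (b n)) fun n => (hp _ _ (hb n)).1
  simp only [← replay_initialSegment, fun n => (hp _ _ (hb n)).2] at hb'
  exact not_not.2 hb'

end Games

/-! ### The compact-open game -/

section CompactOpen

variable {X : Type*} [TopologicalSpace X] {nontrivial : Prop}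

lemma compactNhds_nonempty [Nonempty X] : (compactNhds X nontrivial).Nonempty :=
  ⟨_, mem_image_of_mem _ (⟨singleton_nonempty _, isCompact_singleton⟩ :
    {Classical.arbitrary X} ∈ compacts X)⟩

lemma mem_kCovers_iff {𝒰 : Set (Set X)} : 𝒰 ∈ kCovers X nontrivial ↔
    𝒰 ⊆ admissibleOpens X nontrivial ∧ ∀ K : Set X, IsCompact K → ∃ U ∈ 𝒰, K ⊆ U := by
  refine and_congr_right fun _ => and_iff_right_of_imp fun h => eq_univ_of_forall fun x => ?_
  obtain ⟨U, hU, hx⟩ := h {x} isCompact_singleton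
  exact ⟨U, hU, hx rfl⟩

lemma oneWins_compactNhds_iff [Nonempty X] :
    OneWins (compactNhds X nontrivial) (rangeIn (kCovers X nontrivial))ᶜ ↔
      ∃ κ : List (Set X) → Set X, (∀ l, IsCompact (κ l)) ∧
        ∀ U : ℕ → Set X, (∀ n, U n ∈ admissibleOpens X nontrivial) →
          (∀ n, κ (initialSegment U n) ⊆ U n) → ∀ K, IsCompact K → ∃ n, K ⊆ U n := by
  rw [oneWins_iff compactNhds_nonempty]
  constructor
  · rintro ⟨s, hs, hwin⟩
    choose κ hκ hκs using hs
    refine ⟨κ, fun l => (hκ l).2, fun U hU hκU K hK => ?_⟩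
    have h : range U ∈ kCovers X nontrivial := not_not.1 <| hwin U fun n => by
      rw [← hκs]
      exact ⟨hU n, hκU n⟩
    simpa using h.2.2 K hK
  · rintro ⟨κ, hκ, hwin⟩
    -- A point is added to `κ l` because `compacts X` contains nonempty sets only.
    refine ⟨fun l => {U | U ∈ admissibleOpens X nontrivial ∧
      insert (Classical.arbitrary X) (κ l) ⊆ U}, fun l => ⟨_, ⟨insert_nonempty _ _,
        (hκ l).insert _⟩, rfl⟩, fun U hU => not_not.2 <| mem_kCovers_iff.2
        ⟨range_subset_iff.2 fun n => (hU n).1, fun K hK => ?_⟩⟩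
    simpa using hwin U (fun n => (hU n).1)
      (fun n => (subset_insert _ _).trans (hU n).2) K hK

/-- One's strategy in the compact-open game can be improved so that each compact set lies in all but
finitely many of Two's answers, where Two may answer by any open sets. -/
lemma exists_forall_eventually_subset [Nonempty X]
    (h : OneWins (compactNhds X nontrivial) (rangeIn (kCovers X nontrivial))ᶜ) :
    ∃ κ : List (Set X) → Set X, (∀ l, IsCompact (κ l)) ∧
      ∀ U : ℕ → Set X, (∀ n, IsOpen (U n)) → (∀ n, κ (initialSegment U n) ⊆ U n) →
        ∀ K, IsCompact K → ∀ᶠ n in atTop, K ⊆ U n := by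
  obtain ⟨κ, hκ, hwin⟩ := oneWins_compactNhds_iff.1 h
  refine ⟨fun l => ⋃ l' ∈ {l' | l' ∈ l.sublists}, κ l',
    fun l => (List.finite_toSet _).isCompact_biUnion fun _ _ => hκ _, fun U hU hκU K hK => ?_⟩
  by_contra hcon
  obtain ⟨φ, hφ, hKφ⟩ := extraction_of_frequently_atTop (not_eventually.1 hcon)
  have hsub : ∀ m, ((List.range m).map φ).Sublist (List.range (φ m)) := by
    intro m
    induction m with
    | zero => simp
    | succ m ih =>
      refine List.Sublist.trans ?_ (List.range_sublist.2 (Nat.succ_le_of_lt (hφ m.lt_succ_self)))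
      rw [List.range_succ, List.range_succ, List.map_append]
      exact ih.append (List.Sublist.refl _)
  have hκφ : ∀ n, κ (initialSegment (U ∘ φ) n) ⊆ U (φ n) := fun n => by
    have h : (initialSegment (U ∘ φ) n).Sublist (initialSegment U (φ n)) := by
      simpa [initialSegment] using (hsub n).map U
    exact (subset_biUnion_of_mem (u := κ) (List.mem_sublists.2 h)).trans (hκU (φ n))
  obtain ⟨n, hn⟩ := hwin (U ∘ φ)
    -- The sets `U (φ n)` differ from `univ`, as they do not contain `K`.
    (fun n => ⟨hU _, fun _ hn => hKφ n ((subset_univ K).trans_eq hn.symm)⟩) hκφ K hK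
  exact hKφ n hn

lemma image_mem_kCovers [Nonempty X] {f : Set (Set X) → Set X}
    (hf : ∀ A ∈ compactNhds X nontrivial, f A ∈ A) :
    f '' compactNhds X nontrivial ∈ kCovers X nontrivial := by
  have hf' : ∀ K ∈ compacts X, _ := fun K hK => hf _ (mem_image_of_mem _ hK)
  refine mem_kCovers_iff.2 ⟨?_, fun K hK => ?_⟩
  · rintro _ ⟨_, ⟨K, hK, rfl⟩, rfl⟩
    exact (hf' K hK).1
  · have hK' : insert (Classical.arbitrary X) K ∈ compacts X := ⟨insert_nonempty _ _, hK.insert _⟩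
    exact ⟨_, mem_image_of_mem _ (mem_image_of_mem _ hK'),
      (subset_insert _ _).trans (hf' _ hK').2⟩

end CompactOpen

/-! ### The games on `C(X, ℝ)` -/

section FunctionSpace

variable {X : Type*} [TopologicalSpace X] {nontrivial : Prop}

lemma mem_nhds_iff_exists_isCompact {f : C(X, ℝ)} {s : Set C(X, ℝ)} :
    s ∈ 𝓝 f ↔ ∃ K : Set X, IsCompact K ∧ ∃ ε > 0, {g : C(X, ℝ) | ∀ x ∈ K, |g x - f x| < ε} ⊆ s := by
  rw [(nhds_basis_uniformity'
    Metric.uniformity_basis_dist.compactConvergenceUniformity).mem_iff]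
  simp only [UniformSpace.ball, Prod.exists, and_assoc, exists_and_left, gt_iff_lt]
  refine exists_congr fun K => and_congr_right fun _ => exists_congr fun ε =>
    and_congr_right fun _ => ?_
  simp [Real.dist_eq, abs_sub_comm]

/-- In a completely regular space, a compact set and a closed set disjoint from it are separated by
a real function. -/
lemma exists_continuous_eqOn_zero_one [CompletelyRegularSpace X] {K U : Set X} (hK : IsCompact K)
    (hU : IsOpen U) (hKU : K ⊆ U) : ∃ φ : C(X, ℝ), EqOn φ 0 K ∧ EqOn φ 1 Uᶜ := by
  obtain ⟨V, hV, rfl⟩ := isInducing_stoneCechUnit.isOpen_iff.1 hU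
  obtain ⟨φ, h₀, h₁, -⟩ := exists_continuous_zero_one_of_isClosed
    (hK.image continuous_stoneCechUnit).isClosed hV.isClosed_compl
    (disjoint_compl_right_iff_subset.2 (image_subset_iff.2 hKU))
  exact ⟨φ.comp ⟨stoneCechUnit, continuous_stoneCechUnit⟩,
    fun x hx => h₀ (mem_image_of_mem _ hx), fun x hx => h₁ hx⟩

lemma openNhds_nonempty {Y : Type*} [TopologicalSpace Y] (y : Y) : (openNhds y).Nonempty :=
  ⟨univ, isOpen_univ, mem_univ y⟩

lemma nonemptyOpens_nonempty (Y : Type*) [TopologicalSpace Y] [Nonempty Y] :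
    (nonemptyOpens Y).Nonempty :=
  ⟨univ, isOpen_univ, univ_nonempty⟩

lemma oneWins_convergent [Nonempty X]
    (h : OneWins (compactNhds X nontrivial) (rangeIn (kCovers X nontrivial))ᶜ) :
    OneWins (openNhds (0 : C(X, ℝ))) (convergent (0 : C(X, ℝ)))ᶜ := by
  obtain ⟨κ, hκ, hwin⟩ := exists_forall_eventually_subset h
  -- The set that One's opponent in the compact-open game answers when Two plays `f`
  -- in the round that follows the answers `l`.
  let p : List (Set X) → C(X, ℝ) → Set X := fun l f => {x | |f x| < 1 / (l.length + 1)}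
  refine (oneWins_iff (openNhds_nonempty _)).2
    ⟨fun l => interior {f | κ (replay p l) ⊆ p (replay p l) f}, fun l => ⟨isOpen_interior, ?_⟩,
      fun f hf => not_not.2 ?_⟩
  · refine mem_interior_iff_mem_nhds.2 (mem_nhds_iff_exists_isCompact.2
      ⟨_, hκ (replay p l), 1 / ((replay p l).length + 1), by positivity, fun g hg x hx => ?_⟩)
    simpa only [p, mem_ofPred_eq, ContinuousMap.zero_apply, sub_zero] using hg x hx
  · let U : ℕ → Set X := fun n => p (replay p (initialSegment f n)) (f n)
    have hlen : ∀ n, (replay p (initialSegment f n)).length = n := fun n => by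
      rw [replay_initialSegment]
      simp [initialSegment]
    have hU : ∀ n, U n = {x | |f n x| < 1 / (n + 1)} := fun n => by simp only [U, p, hlen]
    have hwinU := hwin U
      (fun n => hU n ▸ isOpen_lt (f n).continuous.abs continuous_const)
      fun n => (replay_initialSegment p f n) ▸ interior_subset (hf n)
    refine tendsto_def.2 fun s hs => ?_
    obtain ⟨K, hK, ε, hε, hs⟩ := mem_nhds_iff_exists_isCompact.1 hs
    obtain ⟨N, hN⟩ := exists_nat_one_div_lt hε
    filter_upwards [hwinU K hK, eventually_ge_atTop N] with n hn hNn
    refine hs fun x hx => ?_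
    have hx' : |f n x| < 1 / (n + 1) := (hU n).subset (hn hx)
    simpa using (hx'.trans_le (Nat.one_div_le_one_div hNn)).trans hN

lemma convergent_subset_rangeIn_blades {Y : Type*} [TopologicalSpace Y] (y : Y) :
    convergent y ⊆ rangeIn (blades y) := fun _ hs =>
  mem_closure_of_tendsto hs (Eventually.of_forall mem_range_self)

lemma neBot_nhdsNE_zero [Nonempty X] : (𝓝[≠] (0 : C(X, ℝ))).NeBot := by
  rw [← mem_closure_iff_nhdsWithin_neBot]
  have h : Tendsto (fun n : ℕ => ContinuousMap.const X (1 / ((n : ℝ) + 1))) atTop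
      (𝓝 (0 : C(X, ℝ))) :=
    (ContinuousMap.continuous_const'.tendsto 0).comp tendsto_one_div_add_atTop_nhds_zero_nat
  refine mem_closure_of_tendsto h (Eventually.of_forall fun n h0 => ?_)
  have := DFunLike.congr_fun (Set.mem_singleton_iff.1 h0) (Classical.arbitrary X)
  simp only [ContinuousMap.const_apply, ContinuousMap.zero_apply] at this
  exact (Nat.one_div_pos_of_nat (α := ℝ)).ne' this

/-- One forces `0` into the closure of Two's answers while forbidding the answer `0` itself. -/
lemma oneWins_closedDiscrete_of_oneWins_blades [Nonempty X]
    (h : OneWins (openNhds (0 : C(X, ℝ))) (rangeIn (blades (0 : C(X, ℝ))))ᶜ) :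
    OneWins (nonemptyOpens C(X, ℝ)) (rangeIn (closedDiscrete C(X, ℝ))) := by
  obtain ⟨s, hs, hwin⟩ := (oneWins_iff (openNhds_nonempty _)).1 h
  have := neBot_nhdsNE_zero (X := X)
  refine (oneWins_iff (nonemptyOpens_nonempty _)).2
    ⟨fun l => s l \ {0}, fun l => ⟨(hs l).1.sdiff isClosed_singleton, ?_⟩, fun b hb hcd => ?_⟩
  · exact nonempty_of_mem (sdiff_mem_nhdsWithin_compl ((hs l).1.mem_nhds (hs l).2) {0})
  · have h0 : (0 : C(X, ℝ)) ∈ closure (range b) := not_not.1 (hwin b fun n => (hb n).1)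
    rw [hcd.1.closure_eq] at h0
    obtain ⟨n, hn⟩ := h0
    exact (hb n).2 hn

/-- Suppose that One wins a game on the nonempty open sets of `C(X, ℝ)` in which Two would win with
any answers `g n` that take the values `n + 1` on one common compact set. Then One wins the
compact-open game: Two's answers `U n` there are turned into functions that equal `n + 1` off `U n`,
and as One's strategy defeats these functions, no compact set is contained in none of the `U n`. -/
lemma oneWins_compactNhds_of_oneWins_nonemptyOpens [Nonempty X] [CompletelyRegularSpace X]
    {ℬ : Set (ℕ → C(X, ℝ))}
    (hℬ : ∀ (g : ℕ → C(X, ℝ)) (K : Set X), IsCompact K → (∀ n, ∃ x ∈ K, g n x = n + 1) → g ∈ ℬ)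
    (h : OneWins (nonemptyOpens C(X, ℝ)) ℬ) :
    OneWins (compactNhds X nontrivial) (rangeIn (kCovers X nontrivial))ᶜ := by
  obtain ⟨s, hs, hwin⟩ := (oneWins_iff (nonemptyOpens_nonempty _)).1 h
  have hbasic : ∀ l, ∃ K : Set X, IsCompact K ∧ ∃ f : C(X, ℝ), ∀ g : C(X, ℝ),
      EqOn g f K → g ∈ s l := by
    intro l
    obtain ⟨f, hf⟩ := (hs l).2
    obtain ⟨K, hK, ε, hε, hsub⟩ := mem_nhds_iff_exists_isCompact.1 ((hs l).1.mem_nhds hf)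
    exact ⟨K, hK, f, fun g hg => hsub fun x hx => by simpa [hg hx] using hε⟩
  choose κ hκ f hf using hbasic
  -- If Two answers `U` to `κ l`, this answer is translated to the function that is `f l` on `κ l`,
  -- hence a legal move, and `l.length + 1` off `U`.
  have htest : ∀ (l : List C(X, ℝ)) (U : Set X), ∃ g : C(X, ℝ), IsOpen U → κ l ⊆ U →
      EqOn g (f l) (κ l) ∧ ∀ x ∉ U, g x = l.length + 1 := by
    intro l U
    by_cases hU : IsOpen U ∧ κ l ⊆ U
    · obtain ⟨φ, h₀, h₁⟩ := exists_continuous_eqOn_zero_one (hκ l) hU.1 hU.2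
      refine ⟨f l + φ * (ContinuousMap.const X (l.length + 1 : ℝ) - f l), fun _ _ =>
        ⟨fun x hx => ?_, fun x hx => ?_⟩⟩
      · simp [h₀ hx]
      · simp [h₁ hx]
    · exact ⟨0, fun h₁ h₂ => (hU ⟨h₁, h₂⟩).elim⟩
  choose p hp using htest
  refine oneWins_compactNhds_iff.2 ⟨fun l => κ (replay p l), fun l => hκ _, fun U hU hκU K hK => ?_⟩
  by_contra! hcon
  let g : ℕ → C(X, ℝ) := fun n => p (replay p (initialSegment U n)) (U n)
  have hg := fun n => hp _ _ (hU n).1 (hκU n)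
  refine hwin g (fun n => ?_) (hℬ g K hK fun n => ?_)
  · rw [← replay_initialSegment p U n]
    exact hf _ _ (hg n).1
  · obtain ⟨x, hxK, hxU⟩ := not_subset.1 (hcon n)
    refine ⟨x, hxK, ((hg n).2 x hxU).trans ?_⟩
    rw [replay_initialSegment]
    simp [initialSegment]

lemma range_mem_closedDiscrete {g : ℕ → C(X, ℝ)} {K : Set X} (hK : IsCompact K)
    (hg : ∀ n, ∃ x ∈ K, g n x = n + 1) : range g ∈ closedDiscrete C(X, ℝ) := by
  have hfin : LocallyFinite fun n => ({g n} : Set C(X, ℝ)) := by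
    intro f
    obtain ⟨M, hM⟩ := hK.exists_bound_of_continuousOn f.continuous.continuousOn
    refine ⟨_, mem_nhds_iff_exists_isCompact.2 ⟨K, hK, 1, one_pos, subset_rfl⟩,
      (finite_lt_nat ⌈M⌉₊).subset fun n hn => ?_⟩
    obtain ⟨_, rfl, hn⟩ := hn
    obtain ⟨x, hxK, hx⟩ := hg n
    have h₁ := (abs_lt.1 (hn x hxK)).2
    have h₂ := (abs_le.1 (hM x hxK)).2
    exact Nat.lt_ceil.2 (by linarith)
  have hclosed : ∀ t ⊆ range g, IsClosed t := by
    intro t ht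
    have h : t = ⋃ n : {n // g n ∈ t}, {g n} := by
      ext f
      simp only [mem_iUnion, mem_singleton_iff, Subtype.exists, exists_prop]
      constructor
      · intro hf
        obtain ⟨n, rfl⟩ := ht hf
        exact ⟨n, hf, rfl⟩
      · rintro ⟨n, hn, rfl⟩
        exact hn
    rw [h]
    exact (hfin.comp_injective Subtype.val_injective).isClosed_iUnion fun _ => isClosed_singleton
  refine ⟨hclosed _ subset_rfl, discreteTopology_iff_forall_isClosed.2 fun t => ?_⟩
  rw [← preimage_image_eq t Subtype.val_injective]
  exact (hclosed _ (Subtype.coe_image_subset _ t)).preimage continuous_subtype_val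

lemma zero_notMem_closure_range {g : ℕ → C(X, ℝ)} {K : Set X} (hK : IsCompact K)
    (hg : ∀ n, ∃ x ∈ K, g n x = n + 1) : (0 : C(X, ℝ)) ∉ closure (range g) := by
  intro h0
  obtain ⟨_, hn, n, rfl⟩ := mem_closure_iff_nhds.1 h0 _
    (mem_nhds_iff_exists_isCompact.2 ⟨K, hK, 1, one_pos, subset_rfl⟩)
  obtain ⟨x, hxK, hx⟩ := hg n
  have h₁ := (abs_lt.1 (hn x hxK)).2
  simp only [hx, ContinuousMap.zero_apply, sub_zero] at h₁
  linarith [n.cast_nonneg (α := ℝ)]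

end FunctionSpace

end SelectionGames

/-- `C(X, ℝ)` carries the compact-open topology, so it is the space `C_k(X)`. -/
theorem mainTheorem2 (X : Type*) [TopologicalSpace X] [T35Space X] [Nonempty X]
    (nontrivial : Prop) :
    List.TFAE [
      -- the variant of the compact-open game
      SelectionGames.OneWins (SelectionGames.compactNhds X nontrivial)
        (SelectionGames.rangeIn (SelectionGames.kCovers X nontrivial))ᶜ,
      -- Gruenhage's W-game
      SelectionGames.OneWins (SelectionGames.openNhds (0 : C(X, ℝ)))
        (SelectionGames.convergent (0 : C(X, ℝ)))ᶜ,
      -- the closure game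
      SelectionGames.OneWins (SelectionGames.openNhds (0 : C(X, ℝ)))
        (SelectionGames.rangeIn (SelectionGames.blades (0 : C(X, ℝ))))ᶜ,
      -- the closed discrete selection game
      SelectionGames.OneWins (SelectionGames.nonemptyOpens C(X, ℝ))
        (SelectionGames.rangeIn (SelectionGames.closedDiscrete C(X, ℝ))),
      -- the variant of the Rothberger game
      SelectionGames.TwoWins (SelectionGames.kCovers X nontrivial)
        (SelectionGames.rangeIn (SelectionGames.kCovers X nontrivial)),
      -- the countable fan tightness game
      SelectionGames.TwoWins (SelectionGames.blades (0 : C(X, ℝ)))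
        (SelectionGames.rangeIn (SelectionGames.blades (0 : C(X, ℝ)))),
      -- the countable dense fan tightness game
      SelectionGames.TwoWins (SelectionGames.denseSets C(X, ℝ))
        (SelectionGames.rangeIn (SelectionGames.blades (0 : C(X, ℝ))))] := by
  tfae_have 1 → 2 := SelectionGames.oneWins_convergent
  tfae_have 2 → 3 := fun h =>
    h.mono (compl_subset_compl.2 (SelectionGames.convergent_subset_rangeIn_blades 0))
  tfae_have 3 → 4 := SelectionGames.oneWins_closedDiscrete_of_oneWins_blades
  tfae_have 4 → 1 := SelectionGames.oneWins_compactNhds_of_oneWins_nonemptyOpens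
    fun _ _ => SelectionGames.range_mem_closedDiscrete
  tfae_have 1 → 5 := by
    refine SelectionGames.OneWins.twoWins SelectionGames.compactNhds_nonempty ?_
    rintro _ ⟨K, hK, rfl⟩ 𝒰 h𝒰
    obtain ⟨U, hU, hKU⟩ := h𝒰.2.2 K hK.2
    exact ⟨U, ⟨h𝒰.1 hU, hKU⟩, hU⟩
  tfae_have 5 → 1 := SelectionGames.TwoWins.oneWins SelectionGames.compactNhds_nonempty
    fun _ => SelectionGames.image_mem_kCovers
  tfae_have 3 → 6 := SelectionGames.OneWins.twoWins (SelectionGames.openNhds_nonempty _)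
    (fun V hV A hA => mem_closure_iff.1 hA V hV.1 hV.2)
  tfae_have 6 → 7 := fun h => h.anti fun D hD => hD 0
  tfae_have 7 → 1 := fun h => by
    refine SelectionGames.oneWins_compactNhds_of_oneWins_nonemptyOpens
      (fun _ _ => SelectionGames.zero_notMem_closure_range)
      (h.oneWins (SelectionGames.nonemptyOpens_nonempty _) fun f hf => ?_)
    exact dense_iff_inter_open.2 fun W hW hne =>
      ⟨f W, hf W ⟨hW, hne⟩, mem_image_of_mem f ⟨hW, hne⟩⟩
  tfae_finish
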